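/- Let $F$ be a free group of finite rank $k\ge 2$, let $R(F)=\mathrm{Hom}(F,SL(2,\mathbb C))$, and let $X(F)$ be the set of characters $g\mapsto \mathrm{tr}\,\rho(g)$ of representations $\rho\in R(F)$. View $X(F)$ as a subset of $\mathbb C^n$ through the values $x\mapsto (x(g_1),\dots,x(g_n))$ at any finite list $g_1,\dots,g_n\in F$ such that every trace function $\rho\mapsto\mathrm{tr}\,\rho(g)$, $g\in F$, on $R(F)$ is a complex polynomial in the functions $\rho\mapsto \mathrm{tr}\,\rho(g_i)$ (such lists exist). For an ordered free basis $S=(\alpha,\beta,\gamma_3,\dots,\gamma_k)$ of $F$, view $R(F)$ as a subset of $M_2(\mathbb C)^k$ through $\rho\mapsto(\rho(\alpha),\rho(\beta),\rho(\gamma_3),\dots,\rho(\gamma_k))$. Call $\rho\in R(F)$ $S$-good if $$\rho(\alpha)=\begin{pmatrix} a&1\\-1&0\end{pmatrix},\qquad \rho(\beta)=\begin{pmatrix} b&0\\ c&1/b\end{pmatrix},\qquad b\ne 0,\pm1,\qquad \mathrm{tr}\,\rho(\alpha\beta\alpha^{-1}\beta^{-1})\ne 2$$ for some $a,b,c\in\mathbb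 C$, and let $R_S(F)\subset R(F)$ be the set of $S$-good representations. Topological statements refer to the classical topology. A map defined on a subset of an affine space is called smooth if it extends to a $C^\infty$ map (in the real sense) on an open neighborhood of that subset. A diffeomorphism between such subsets is a smooth bijection with smooth inverse. A point of $X(F)$ is called a smooth point if it has a neighborhood in $X(F)$ that is a smooth submanifold of $\mathbb C^n$. **Theorem.** Let $x_0\in X(F)$ be the character of an irreducible representation $F\to SL(2,\mathbb C)$ (one with no invariant subspace of $\mathbb C^2$ other than $0$ and $\mathbb C^2$). Then $x_0$ is a smooth point of $X(F)$. Moreover, there are an open neighborhood $U\subset X(F)$ of $x_0$, an ordered free basis $S$ of $F$, and an open subset $V\subset R_S(F)$ such that the map sending a representation to its character restricts to a diffeomorphism $V\to U$. -/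

import Mathlib

open scoped ContDiff

/-! ### Representations into `SL(2, ℂ)` and their characters -/

/-- The set `R(G)` of all homomorphisms `G → SL(2, ℂ)`. -/
abbrev SL2Rep (G : Type*) [Group G] : Type _ :=
  G →* Matrix.SpecialLinearGroup (Fin 2) ℂ

namespace SL2Rep

/-- The linear action of `G` on `ℂ²` given by `ρ : G → SL(2, ℂ)`. -/
noncomputable def toRepresentation {G : Type*} [Group G] (ρ : SL2Rep G) :
    Representation ℂ G (Fin 2 → ℂ) :=
  LinearEquiv.automorphismGroup.toLinearMapMonoidHom.comp
    (Matrix.SpecialLinearGroup.toLin'.comp ρ)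

/-- `ρ` is irreducible: `ℂ²` has no invariant subspace other than `0` and `ℂ²`. -/
def IsIrreducible {G : Type*} [Group G] (ρ : SL2Rep G) : Prop :=
  Representation.IsIrreducible ρ.toRepresentation

/-- The character `g ↦ tr ρ(g)` of a representation. -/
def character {G : Type*} [Group G] (ρ : SL2Rep G) : G → ℂ :=
  fun g => Matrix.trace (ρ g : Matrix (Fin 2) (Fin 2) ℂ)

end SL2Rep

/-! ### The character variety -/

/-- The set of all characters of representations `G → SL(2, ℂ)`. -/
def characterSet (G : Type*) [Group G] : Set (G → ℂ) :=
  Set.range (SL2Rep.character (G := G))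

/-- The elements `γ₁, …, γₙ` form a system of trace coordinates for `G`: the functions
`ρ ↦ tr ρ(γᵢ)` on `R(G)` generate the `ℂ`-algebra of functions on `R(G)` generated by all
trace functions `ρ ↦ tr ρ(g)`, `g ∈ G`. -/
def IsTraceCoordinateSystem {G : Type*} [Group G] {n : ℕ} (γ : Fin n → G) : Prop :=
  ∀ g : G, (fun ρ : SL2Rep G => ρ.character g) ∈
    Algebra.adjoin ℂ (Set.range fun i : Fin n => fun ρ : SL2Rep G => ρ.character (γ i))

/-- The values at `γ₁, …, γₙ` of a function on `G`, as a point of `ℂⁿ`. -/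
def traceCoords {G : Type*} {n : ℕ} (γ : Fin n → G) (χ : G → ℂ) : Fin n → ℂ :=
  fun i => χ (γ i)

/-- The character variety `X(G)` as a subset of the affine space `ℂⁿ`, through a system
`γ₁, …, γₙ` of trace coordinates. -/
def characterVariety {G : Type*} [Group G] {n : ℕ} (γ : Fin n → G) : Set (Fin n → ℂ) :=
  traceCoords γ '' characterSet G

/-- `tr(U X V X W) = tr(X V) tr(U X W) - tr(V) tr(U W) + tr(U V W)` in `SL(2, ℂ)`. -/
theorem trace_repeated_letter (U X V W : Matrix (Fin 2) (Fin 2) ℂ) (hX : X.det = 1) :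
    (U * X * V * X * W).trace =
      (X * V).trace * (U * X * W).trace - V.trace * (U * W).trace + (U * V * W).trace := by
  have key : X * V * X = (X * V).trace • X - V.trace • (1 : Matrix (Fin 2) (Fin 2) ℂ) + V := by
    rw [Matrix.det_fin_two] at hX
    ext i j
    fin_cases i <;> fin_cases j <;>
      simp [Matrix.mul_apply, Fin.sum_univ_two, Matrix.trace_fin_two]
    · linear_combination (-(V 1 1)) * hX
    · linear_combination (V 0 1) * hX
    · linear_combination (V 1 0) * hX
    · linear_combination (-(V 0 0)) * hX
  have : U * X * V * X * W = U * (X * V * X) * W := by simp only [mul_assoc]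
  rw [this, key]
  simp [mul_add, add_mul, mul_sub, sub_mul, Matrix.trace_add, Matrix.trace_sub, smul_eq_mul]

/-- Every finitely generated free group has a finite system of trace coordinates. -/
theorem exists_isTraceCoordinateSystem {G : Type*} [Group G] {k : ℕ}
    (B : FreeGroupBasis (Fin k) G) :
    ∃ (n : ℕ) (γ : Fin n → G), IsTraceCoordinateSystem γ := by
  classical
  let w : Fin k × Bool → G := fun p => cond p.2 (B p.1) (B p.1)⁻¹
  let e := Fintype.equivFin {l : List (Fin k × Bool) // l.Nodup}
  refine ⟨_, fun i => ((e.symm i).1.map w).prod, fun g => ?_⟩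
  set A := Algebra.adjoin ℂ (Set.range fun i => fun ρ : SL2Rep G =>
    ρ.character (((e.symm i).1.map w).prod)) with hA
  have main : ∀ (m : ℕ) (l : List (Fin k × Bool)), l.length = m →
      (fun ρ : SL2Rep G => ρ.character ((l.map w).prod)) ∈ A := by
    intro m
    induction m using Nat.strong_induction_on with
    | _ m ih =>
      intro l hl
      by_cases hn : l.Nodup
      · refine Algebra.subset_adjoin ⟨e ⟨l, hn⟩, ?_⟩
        simp
      · obtain ⟨x, hx⟩ := List.exists_duplicate_iff_not_nodup.mpr hn
        have hdec : ∀ l : List (Fin k × Bool), List.Duplicate x l →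
            ∃ u v t, l = u ++ x :: (v ++ x :: t) := by
          intro l h
          induction h with
          | cons_mem h =>
            obtain ⟨v, t, rfl⟩ := List.append_of_mem h
            exact ⟨[], v, t, rfl⟩
          | @cons_duplicate y l h ih =>
            obtain ⟨u, v, t, rfl⟩ := ih
            exact ⟨y :: u, v, t, rfl⟩
        obtain ⟨u, v, t, rfl⟩ := hdec l hx
        simp only [List.length_append, List.length_cons] at hl
        have h1 := ih _ (by simp; omega) (x :: v) rfl
        have h2 := ih _ (by simp; omega) (u ++ x :: t) rfl
        have h3 := ih _ (by omega) v rfl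
        have h4 := ih _ (by simp; omega) (u ++ t) rfl
        have h5 := ih _ (by simp; omega) (u ++ (v ++ t)) rfl
        have := A.add_mem (A.sub_mem (A.mul_mem h1 h2) (A.mul_mem h3 h4)) h5
        convert this using 1
        funext ρ
        have := trace_repeated_letter (ρ (u.map w).prod).1 (ρ (w x)).1 (ρ (v.map w).prod).1
          (ρ (t.map w).prod).1 (ρ (w x)).2
        simpa [SL2Rep.character, mul_assoc] using this
  have hg : g = ((FreeGroup.toWord (B.repr g)).map w).prod := by
    have h1 : (FreeGroup.lift (fun i => B i)) (B.repr g) = g := by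
      have : (FreeGroup.lift (fun i => B i)).comp B.repr.toMonoidHom = MonoidHom.id G :=
        B.ext_hom _ _ (fun i => by simp)
      exact DFunLike.congr_fun this g
    conv_lhs => rw [← h1, ← FreeGroup.mk_toWord (x := B.repr g)]
    rw [FreeGroup.lift_mk]
  rw [hg]
  exact main _ _ rfl

/-! ### Smoothness on subsets of affine spaces -/

/-- A map defined on a subset `s` of an affine space is smooth if it is the restriction of a
smooth map defined on an open set containing `s`. -/
def SmoothOnSubset {E E' : Type*} [NormedAddCommGroup E] [NormedSpace ℝ E]
    [NormedAddCommGroup E'] [NormedSpace ℝ E'] {s : Set E} (f : s → E') : Prop :=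
  ∃ (O : Set E) (g : E → E'), IsOpen O ∧ s ⊆ O ∧ ContDiffOn ℝ ∞ g O ∧ ∀ x : s, g x = f x

/-- A bijection between subsets of affine spaces is a diffeomorphism if it and its inverse are
smooth. -/
def IsDiffeoOfSubsets {E E' : Type*} [NormedAddCommGroup E] [NormedSpace ℝ E]
    [NormedAddCommGroup E'] [NormedSpace ℝ E'] {s : Set E} {t : Set E'} (f : s ≃ t) : Prop :=
  SmoothOnSubset (fun x : s => (f x : E')) ∧ SmoothOnSubset (fun y : t => (f.symm y : E))

/-- `U` is a relatively open subset of `X`. -/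
def IsRelOpen {E : Type*} [TopologicalSpace E] (X U : Set E) : Prop :=
  ∃ O : Set E, IsOpen O ∧ U = X ∩ O

/-- `M` is a `d`-dimensional smooth (embedded) submanifold of `E`: around each of its points
there is a smooth change of coordinates of `E` that carries `M` to a `d`-dimensional linear
subspace. -/
def IsSmoothSubmanifold {E : Type*} [NormedAddCommGroup E] [NormedSpace ℝ E]
    (d : ℕ) (M : Set E) : Prop :=
  ∀ p ∈ M, ∃ (Φ : OpenPartialHomeomorph E E) (L : Submodule ℝ E),
    p ∈ Φ.source ∧ ContDiffOn ℝ ∞ Φ Φ.source ∧ ContDiffOn ℝ ∞ Φ.symm Φ.target ∧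
    Module.finrank ℝ L = d ∧ Φ '' (M ∩ Φ.source) = (L : Set E) ∩ Φ.target

/-- `p` is a smooth point of `X ⊆ E`: it has a neighborhood in `X` that is a smooth
submanifold of `E`. -/
def IsSmoothPoint {E : Type*} [NormedAddCommGroup E] [NormedSpace ℝ E]
    (X : Set E) (p : E) : Prop :=
  ∃ U : Set E, IsRelOpen X U ∧ p ∈ U ∧ ∃ d : ℕ, IsSmoothSubmanifold d U

/-! ### Good representations of a free group -/

/-- The point of the affine space `M₂(ℂ)ᵏ` given by the matrices `ρ(s₁), …, ρ(sₖ)`, where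
`S = (s₁, …, sₖ)` is an ordered free basis. -/
def repCoords {F : Type*} [Group F] {k : ℕ} (S : FreeGroupBasis (Fin k) F) (ρ : SL2Rep F) :
    Fin k → Fin 2 → Fin 2 → ℂ :=
  fun i a b => (ρ (S i) : Matrix (Fin 2) (Fin 2) ℂ) a b

/-- The set of `S`-good representations, for an ordered free basis `S = (α, β, γ₃, …, γₖ)`,
`k ≥ 2`. -/
def goodRepresentations {F : Type*} [Group F] {k : ℕ} (hk : 2 ≤ k)
    (S : FreeGroupBasis (Fin k) F) : Set (SL2Rep F) :=
  let α : F := S ⟨0, by omega⟩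
  let β : F := S ⟨1, by omega⟩
  {ρ | (∃ a : ℂ, (ρ α : Matrix (Fin 2) (Fin 2) ℂ) = !![a, 1; -1, 0]) ∧
    (∃ b c : ℂ, b ≠ 0 ∧ b ≠ 1 ∧ b ≠ -1 ∧
      (ρ β : Matrix (Fin 2) (Fin 2) ℂ) = !![b, 0; c, 1 / b]) ∧
    ρ.character (α * β * α⁻¹ * β⁻¹) ≠ 2}

/-! Some basis `S` makes the given representation irreducible on its first two elements α, β, that
is tr [α, β] ≠ 2, with tr β ≠ ±2 besides (`exists_adapted_basis`). Both conditions are open on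
characters. Under them a representation is conjugate to an `S`-good one (`exists_conj_normal_form`),
the only freedom being the choice between the eigenvalues b and 1/b of β. A local branch of the
solution of b + 1/b = tr β removes this ambiguity.

The good representation is then a smooth function of the character: a = tr α, b is the branch, c =
tr αβ - ab, and each further matrix M solves a linear system given by the traces of M, αM, βM, αβM,
whose determinant is 2 - tr [α, β] up to an invertible constant (`matrixOfTraces_eq`).

Smoothness of the variety needs no equations and no dimension count. The reconstruction r extends to
an open subset of ℂⁿ and still takes values in good representations, because determinants can be
renormalized (`exists_smooth_inverse`). If τ is the trace map, τ ∘ r is a smooth retraction of an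
open set onto the neighborhood U, and the image of a smooth retraction is a submanifold
(`exists_isSmoothSubmanifold_of_retraction`). -/

/-! ### Smooth retracts are submanifolds -/

section Retract

variable {E : Type*} [NormedAddCommGroup E] [NormedSpace ℝ E]
  {O M : Set E} {q : E → E} {p : E}

/-- The derivative of a smooth retraction at a fixed point is idempotent. -/
theorem fderiv_retraction_idem (hO : IsOpen O) (hq : ContDiffOn ℝ ∞ q O) (hMO : M ⊆ O)
    (hmap : ∀ x ∈ O, q x ∈ M) (hfix : ∀ x ∈ M, q x = x) (hp : p ∈ M) :
    (fderiv ℝ q p).comp (fderiv ℝ q p) = fderiv ℝ q p := by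
  have hd : DifferentiableAt ℝ q p :=
    (hq.contDiffAt (hO.mem_nhds (hMO hp))).differentiableAt (by simp)
  have h1 : HasFDerivAt q (fderiv ℝ q p) (q p) := by
    rw [hfix p hp]; exact hd.hasFDerivAt
  have h2 := h1.comp p hd.hasFDerivAt
  have h3 : q ∘ q =ᶠ[nhds p] q := by
    filter_upwards [hO.mem_nhds (hMO hp)] with x hx
    exact hfix _ (hmap x hx)
  exact (h2.congr_of_eventuallyEq h3.symm).unique hd.hasFDerivAt

/-- The image of a smooth retraction is locally straightened by a change of coordinates. -/
theorem exists_chart_of_retraction [CompleteSpace E] (hO : IsOpen O) (hq : ContDiffOn ℝ ∞ q O)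
    (hMO : M ⊆ O) (hmap : ∀ x ∈ O, q x ∈ M) (hfix : ∀ x ∈ M, q x = x) (hp : p ∈ M) :
    ∃ Φ : OpenPartialHomeomorph E E, p ∈ Φ.source ∧ ContDiffOn ℝ ∞ Φ Φ.source ∧
      ContDiffOn ℝ ∞ Φ.symm Φ.target ∧
      Φ '' (M ∩ Φ.source) = (LinearMap.range (fderiv ℝ q p).toLinearMap : Set E) ∩ Φ.target := by
  set P := fderiv ℝ q p with hP
  have hPP : ∀ v, P (P v) = P v := fun v =>
    DFunLike.congr_fun (fderiv_retraction_idem hO hq hMO hmap hfix hp) v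
  -- The chart measures `q x` along the range of `P` and the displacement `x - q x` along its
  -- kernel. Its derivative at `p` is P² + (1 - P)² = 1, and it turns `q` into the linear projection
  -- `P`.
  let φ : E → E := fun x => P (q x - p) + ((x - q x) - P (x - q x))
  have hφ : ContDiffOn ℝ ∞ φ O := by
    have h1 : ContDiffOn ℝ ∞ (fun x => x - q x) O := contDiffOn_id.sub hq
    exact (P.contDiff.comp_contDiffOn (hq.sub contDiffOn_const)).add
      (h1.sub (P.contDiff.comp_contDiffOn h1))
  have hφq : ∀ x ∈ O, φ (q x) = P (φ x) := by
    intro x hx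
    simp [φ, hfix _ (hmap x hx), hPP]
  have hφM : ∀ x ∈ M, φ x = P (x - p) := by
    intro x hx
    simp [φ, hfix _ hx]
  have hd : HasFDerivAt φ ((ContinuousLinearEquiv.refl ℝ E : E ≃L[ℝ] E) : E →L[ℝ] E) p := by
    have hqd : HasFDerivAt q P p :=
      ((hq.contDiffAt (hO.mem_nhds (hMO hp))).differentiableAt (by simp)).hasFDerivAt
    have h1 : HasFDerivAt (fun x => x - q x) (ContinuousLinearMap.id ℝ E - P) p :=
      (hasFDerivAt_id p).sub hqd
    have h2 := ((P.hasFDerivAt.comp p (hqd.sub_const p)).add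
      (h1.sub (P.hasFDerivAt.comp p h1)))
    convert! h2 using 1
    ext v
    simp [hPP]
  have hpO : O ∈ nhds p := hO.mem_nhds (hMO hp)
  have hφp : ContDiffAt ℝ ∞ φ p := hφ.contDiffAt hpO
  let Ψ := hφp.toOpenPartialHomeomorph φ hd (by simp)
  have hΨ : (Ψ : E → E) = φ := hφp.toOpenPartialHomeomorph_coe hd (by simp)
  have hpΨ : p ∈ Ψ.source := hφp.mem_toOpenPartialHomeomorph_source hd (by simp)
  -- Invertibility of the derivative on all of `W₁` makes the inverse smooth on the whole target,
  -- not only at the image of `p`.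
  let W₁ : Set E := O ∩ (fderiv ℝ φ) ⁻¹' Set.range ((↑) : (E ≃L[ℝ] E) → (E →L[ℝ] E))
  have hW₁ : IsOpen W₁ :=
    (hφ.continuousOn_fderiv_of_isOpen hO (by simp)).isOpen_inter_preimage hO
      ContinuousLinearEquiv.isOpen
  have hpW₁ : p ∈ W₁ := ⟨hMO hp, ⟨_, hd.fderiv.symm⟩⟩
  -- On `W₂` both `x` and `q x` lie where `φ` is injective (once `x` is in `Ψ.source`), so φ(q x) =
  -- φ(x) forces q x = x.
  let W₂ : Set E := O ∩ q ⁻¹' Ψ.source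
  have hW₂ : IsOpen W₂ := hq.continuousOn.isOpen_inter_preimage hO Ψ.open_source
  have hpW₂ : p ∈ W₂ := ⟨hMO hp, by simpa [hfix p hp] using hpΨ⟩
  let Φ := Ψ.restrOpen (W₁ ∩ W₂) (hW₁.inter hW₂)
  have hΦs : Φ.source = Ψ.source ∩ (W₁ ∩ W₂) := rfl
  have hΦ : (Φ : E → E) = φ := hΨ
  have hΦΨ : (Φ.symm : E → E) = Ψ.symm := rfl
  refine ⟨Φ, ⟨hpΨ, hpW₁, hpW₂⟩, ?_, ?_, ?_⟩
  · rw [hΦ]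
    exact hφ.mono fun x hx => hx.2.1.1
  · intro y hy
    have hx := Φ.map_target hy
    obtain ⟨e, he⟩ := hx.2.1.2
    have hxO : O ∈ nhds (Φ.symm y) := hO.mem_nhds hx.2.1.1
    refine (Φ.contDiffAt_symm (f₀' := e) hy ?_ ?_).contDiffWithinAt
    · rw [hΦ, he]
      exact ((hφ.contDiffAt hxO).differentiableAt (by simp)).hasFDerivAt
    · rw [hΦ]
      exact hφ.contDiffAt hxO
  · ext y
    constructor
    · rintro ⟨x, ⟨hxM, hx⟩, rfl⟩
      refine ⟨?_, Φ.map_source hx⟩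
      rw [hΦ, hφM x hxM]
      exact ⟨_, rfl⟩
    · rintro ⟨⟨w, hw⟩, hy⟩
      have hx := Φ.map_target hy
      refine ⟨Φ.symm y, ⟨?_, hx⟩, Φ.right_inv hy⟩
      have hφx : φ (Φ.symm y) = y := by rw [← hΦ]; exact Φ.right_inv hy
      have hyP : P y = y := by rw [← hw]; exact hPP w
      have h1 : φ (q (Φ.symm y)) = φ (Φ.symm y) := by
        rw [hφq _ hx.2.1.1, hφx, hyP]
      have h2 : q (Φ.symm y) = Φ.symm y := Ψ.injOn hx.2.2.2 hx.1 (by rw [hΨ]; exact h1)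
      rw [← h2]
      exact hmap _ hx.2.1.1

/-- The trace of an idempotent continuous linear map is its rank. -/
theorem trace_eq_finrank_range_of_idem [FiniteDimensional ℝ E] {P : E →L[ℝ] E}
    (hP : P.comp P = P) :
    LinearMap.trace ℝ E P.toLinearMap = Module.finrank ℝ (LinearMap.range P.toLinearMap) := by
  refine LinearMap.IsProj.trace (f := P.toLinearMap) ⟨fun x => ⟨x, rfl⟩, ?_⟩
  rintro _ ⟨x, rfl⟩
  exact DFunLike.congr_fun hP x

/-- Every point of the image of a smooth retraction is a smooth point. -/
theorem exists_isSmoothSubmanifold_of_retraction [FiniteDimensional ℝ E] (hO : IsOpen O)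
    (hq : ContDiffOn ℝ ∞ q O) (hMO : M ⊆ O) (hmap : ∀ x ∈ O, q x ∈ M)
    (hfix : ∀ x ∈ M, q x = x) (hp : p ∈ M) :
    ∃ W : Set E, IsOpen W ∧ p ∈ W ∧ ∃ d : ℕ, IsSmoothSubmanifold d (M ∩ W) := by
  have : CompleteSpace E := FiniteDimensional.complete ℝ E
  let τ : E → ℝ := fun x => LinearMap.trace ℝ E (fderiv ℝ q x).toLinearMap
  have hτ : ContinuousOn τ O := by
    have h : Continuous fun A : E →L[ℝ] E => LinearMap.trace ℝ E A.toLinearMap :=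
      LinearMap.continuous_of_finiteDimensional
        ((LinearMap.trace ℝ E).comp (ContinuousLinearMap.coeLM ℝ))
    exact h.comp_continuousOn (hq.continuousOn_fderiv_of_isOpen hO (by simp))
  -- At points of `M` the trace of the derivative is an integer, the rank; staying within distance
  -- less than 1 of its value at `p` keeps the rank constant.
  let W : Set E := O ∩ τ ⁻¹' Metric.ball (τ p) 1
  have hW : IsOpen W := hτ.isOpen_inter_preimage hO Metric.isOpen_ball
  have hpW : p ∈ W := ⟨hMO hp, by simp⟩
  refine ⟨W, hW, hpW, Module.finrank ℝ (LinearMap.range (fderiv ℝ q p).toLinearMap), ?_⟩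
  rintro x ⟨hxM, hxW⟩
  -- Shrinking the domain to points sent into `W` makes `q` a retraction onto `M ∩ W`.
  have hO' : IsOpen (O ∩ q ⁻¹' W) := hq.continuousOn.isOpen_inter_preimage hO hW
  obtain ⟨Φ, h1, h2, h3, h4⟩ := exists_chart_of_retraction (M := M ∩ W) (p := x) hO'
    (hq.mono Set.inter_subset_left)
    (fun y hy => ⟨hMO hy.1, by simpa [hfix y hy.1] using hy.2⟩)
    (fun y hy => ⟨hmap y hy.1, hy.2⟩) (fun y hy => hfix y hy.1) ⟨hxM, hxW⟩
  refine ⟨Φ, _, h1, h2, h3, ?_, h4⟩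
  have hx := trace_eq_finrank_range_of_idem (fderiv_retraction_idem hO hq hMO hmap hfix hxM)
  have hp' := trace_eq_finrank_range_of_idem (fderiv_retraction_idem hO hq hMO hmap hfix hp)
  have hxp : dist (τ x) (τ p) < 1 := hxW.2
  simp only [τ, hx, hp', Nat.dist_cast_real] at hxp
  have h5 : dist (Module.finrank ℝ (LinearMap.range (fderiv ℝ q x).toLinearMap))
    (Module.finrank ℝ (LinearMap.range (fderiv ℝ q p).toLinearMap)) < 1 := hxp
  rw [Nat.dist_eq] at h5
  have h6 : |((Module.finrank ℝ (LinearMap.range (fderiv ℝ q x).toLinearMap) : ℤ)) -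
    (Module.finrank ℝ (LinearMap.range (fderiv ℝ q p).toLinearMap) : ℤ)| < 1 := by
    exact_mod_cast h5
  rw [abs_lt] at h6
  omega

end Retract

/-! ### Invariant lines of matrices in `SL(2, ℂ)` -/

section InvariantLines

open Matrix

/-- The quadratic form `det (v, A v)`, whose zeros are the eigenvectors of `A`. -/
def lineForm (A : Matrix (Fin 2) (Fin 2) ℂ) (v : Fin 2 → ℂ) : ℂ :=
  v 0 * (A *ᵥ v) 1 - v 1 * (A *ᵥ v) 0

theorem lineForm_eq (A : Matrix (Fin 2) (Fin 2) ℂ) (v : Fin 2 → ℂ) :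
    lineForm A v = A 1 0 * v 0 ^ 2 + (A 1 1 - A 0 0) * v 0 * v 1 - A 0 1 * v 1 ^ 2 := by
  simp [lineForm, Matrix.mulVec, dotProduct, Fin.sum_univ_two]
  ring

theorem exists_mulVec_eq_smul_of_lineForm_eq_zero {A : Matrix (Fin 2) (Fin 2) ℂ}
    {v : Fin 2 → ℂ} (hv : v ≠ 0) (h : lineForm A v = 0) : ∃ μ : ℂ, A *ᵥ v = μ • v := by
  unfold lineForm at h
  by_cases h0 : v 0 = 0
  · have h1 : v 1 ≠ 0 := fun h1 => hv (by ext i; fin_cases i <;> simpa)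
    refine ⟨(A *ᵥ v) 1 / v 1, ?_⟩
    have h2 : (A *ᵥ v) 0 = 0 := by simpa [h0, h1] using h
    ext i
    fin_cases i
    · simp [h0, h2]
    · simp [h1]
  · refine ⟨(A *ᵥ v) 0 / v 0, ?_⟩
    ext i
    fin_cases i
    · simp [h0]
    · simp only [Fin.mk_one, Pi.smul_apply, smul_eq_mul]
      field_simp
      linear_combination h

theorem lineForm_eq_zero_of_mulVec_eq_smul {A : Matrix (Fin 2) (Fin 2) ℂ}
    {v : Fin 2 → ℂ} {μ : ℂ} (h : A *ᵥ v = μ • v) : lineForm A v = 0 := by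
  simp [lineForm, h]
  ring

theorem eigenvalue_ne_zero_of_det_eq_one {A : Matrix (Fin 2) (Fin 2) ℂ} (hA : A.det = 1)
    {v : Fin 2 → ℂ} (hv : v ≠ 0) {μ : ℂ} (h : A *ᵥ v = μ • v) : μ ≠ 0 := by
  rintro rfl
  rw [zero_smul] at h
  have := Matrix.exists_mulVec_eq_zero_iff.mp ⟨v, hv, h⟩
  simp [hA] at this

/-- If `B` preserves the line of `v` and `A` does not, then neither does `A * B`. -/
theorem lineForm_mul_ne_zero_of_right {A B : Matrix (Fin 2) (Fin 2) ℂ} (hB : B.det = 1)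
    {v : Fin 2 → ℂ} (hv : v ≠ 0) (hA : lineForm A v ≠ 0) (h : lineForm B v = 0) :
    lineForm (A * B) v ≠ 0 := by
  obtain ⟨μ, hμ⟩ := exists_mulVec_eq_smul_of_lineForm_eq_zero hv h
  have hμ0 := eigenvalue_ne_zero_of_det_eq_one hB hv hμ
  have : lineForm (A * B) v = μ * lineForm A v := by
    simp only [lineForm, ← Matrix.mulVec_mulVec, hμ, Matrix.mulVec_smul, Pi.smul_apply,
      smul_eq_mul]
    ring
  rw [this]
  exact mul_ne_zero hμ0 hA

/-- If `A` preserves the line of `v` and `B` does not, then neither does `A * B`. -/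
theorem lineForm_mul_ne_zero_of_left {A B : Matrix (Fin 2) (Fin 2) ℂ} (hA : A.det = 1)
    {v : Fin 2 → ℂ} (hv : v ≠ 0) (h : lineForm A v = 0) (hB : lineForm B v ≠ 0) :
    lineForm (A * B) v ≠ 0 := by
  obtain ⟨μ, hμ⟩ := exists_mulVec_eq_smul_of_lineForm_eq_zero hv h
  intro h0
  apply hB
  have h1 : (A *ᵥ v) 0 * (A *ᵥ (B *ᵥ v)) 1 - (A *ᵥ v) 1 * (A *ᵥ (B *ᵥ v)) 0 =
      A.det * lineForm B v := by
    generalize hw : B *ᵥ v = w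
    simp only [lineForm, hw, Matrix.det_fin_two]
    simp [Matrix.mulVec, dotProduct, Fin.sum_univ_two]
    ring
  rw [hA, one_mul] at h1
  rw [← h1, hμ]
  simp only [lineForm, ← Matrix.mulVec_mulVec] at h0
  simp only [Pi.smul_apply, smul_eq_mul]
  linear_combination μ * h0

/-- The right-hand side is the resultant of the binary quadratic forms `lineForm A` and `lineForm
B`; it vanishes exactly when `A` and `B` share an eigenvector. -/
theorem trace_commutator_sub_two (A B : SpecialLinearGroup (Fin 2) ℂ) :
    (A * B * A⁻¹ * B⁻¹).1.trace - 2 =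
      (A.1 0 1 * B.1 1 0 - B.1 0 1 * A.1 1 0) ^ 2 +
      (A.1 0 1 * (B.1 1 1 - B.1 0 0) - B.1 0 1 * (A.1 1 1 - A.1 0 0)) *
      ((A.1 1 1 - A.1 0 0) * B.1 1 0 - (B.1 1 1 - B.1 0 0) * A.1 1 0) := by
  have hA := A.2
  have hB := B.2
  rw [Matrix.det_fin_two] at hA hB
  simp only [Matrix.SpecialLinearGroup.coe_mul, Matrix.SpecialLinearGroup.coe_inv, Matrix.adjugate_fin_two]
  simp [Matrix.trace_fin_two, Matrix.mul_apply, Fin.sum_univ_two]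
  linear_combination 2 * (B.1 0 0 * B.1 1 1 - B.1 0 1 * B.1 1 0) * hA + 2 * hB

/-- Fricke's identity. -/
theorem trace_commutator (A B : SpecialLinearGroup (Fin 2) ℂ) :
    (A * B * A⁻¹ * B⁻¹).1.trace = A.1.trace ^ 2 + B.1.trace ^ 2 + (A * B).1.trace ^ 2 -
      A.1.trace * B.1.trace * (A * B).1.trace - 2 := by
  have hA := A.2
  have hB := B.2
  rw [Matrix.det_fin_two] at hA hB
  simp only [Matrix.SpecialLinearGroup.coe_mul, Matrix.SpecialLinearGroup.coe_inv,
    Matrix.adjugate_fin_two]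
  simp [Matrix.trace_fin_two, Matrix.mul_apply, Fin.sum_univ_two]
  linear_combination ((B.1 0 0 + B.1 1 1) ^ 2 - 2 * (B.1 0 0 * B.1 1 1 - B.1 0 1 * B.1 1 0)) * hA
    + ((A.1 0 0 + A.1 1 1) ^ 2 - 2) * hB

/-- Cayley–Hamilton gives A + A⁻¹ = (tr A) · 1; multiply by `B` and take traces. -/
theorem trace_mul_inv (A B : SpecialLinearGroup (Fin 2) ℂ) :
    (B * A⁻¹).1.trace = A.1.trace * B.1.trace - (A * B).1.trace := by
  simp only [Matrix.SpecialLinearGroup.coe_mul, Matrix.SpecialLinearGroup.coe_inv, Matrix.adjugate_fin_two]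
  simp [Matrix.trace_fin_two, Matrix.mul_apply, Fin.sum_univ_two]
  ring

theorem trace_inv (A : SpecialLinearGroup (Fin 2) ℂ) : (A⁻¹).1.trace = A.1.trace := by
  simp only [Matrix.SpecialLinearGroup.coe_inv, Matrix.adjugate_fin_two]
  simp [Matrix.trace_fin_two, add_comm]

theorem trace_conj (Q A : SpecialLinearGroup (Fin 2) ℂ) :
    (Q * A * Q⁻¹).1.trace = A.1.trace := by
  rw [Matrix.SpecialLinearGroup.coe_mul, Matrix.trace_mul_comm, ← Matrix.SpecialLinearGroup.coe_mul,
    ← mul_assoc, inv_mul_cancel, one_mul]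

/-- Matrices with a common eigenvector have a commutator of trace `2`. -/
theorem trace_commutator_eq_two_of_common {A B : SpecialLinearGroup (Fin 2) ℂ}
    {v : Fin 2 → ℂ} (hv : v ≠ 0) (hA : lineForm A.1 v = 0) (hB : lineForm B.1 v = 0) :
    (A * B * A⁻¹ * B⁻¹).1.trace = 2 := by
  rw [← sub_eq_zero, trace_commutator_sub_two]
  rw [lineForm_eq] at hA hB
  by_cases h0 : v 0 = 0
  · have h1 : v 1 ≠ 0 := fun h1 => hv (by ext i; fin_cases i <;> simpa)
    have hA' : A.1 0 1 = 0 := by simpa [h0, h1] using hA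
    have hB' : B.1 0 1 = 0 := by simpa [h0, h1] using hB
    rw [hA', hB']
    ring
  · have hA' : A.1 1 0 = -(A.1 1 1 - A.1 0 0) * (v 1 / v 0) + A.1 0 1 * (v 1 / v 0) ^ 2 := by
      field_simp
      linear_combination hA
    have hB' : B.1 1 0 = -(B.1 1 1 - B.1 0 0) * (v 1 / v 0) + B.1 0 1 * (v 1 / v 0) ^ 2 := by
      field_simp
      linear_combination hB
    rw [hA', hB']
    ring

/-- The two eigenvectors of `A` control the trace of the commutator of `A` and `B`. -/
theorem exists_lineForm_mul_lineForm {A : SpecialLinearGroup (Fin 2) ℂ} (hA : A.1 1 0 ≠ 0) :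
    ∃ v w : Fin 2 → ℂ, v ≠ 0 ∧ w ≠ 0 ∧ lineForm A.1 v = 0 ∧ lineForm A.1 w = 0 ∧
      ∀ B : SpecialLinearGroup (Fin 2) ℂ,
        (A * B * A⁻¹ * B⁻¹).1.trace = 2 ↔ lineForm B.1 v = 0 ∨ lineForm B.1 w = 0 := by
  -- `s` is a square root of the discriminant of `lineForm A`, whose zeros then have slopes given by
  -- the quadratic formula. They may coincide.
  obtain ⟨s, hs⟩ := IsAlgClosed.exists_eq_mul_self
    ((A.1 1 1 - A.1 0 0) ^ 2 + 4 * A.1 1 0 * A.1 0 1)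
  have hs' : s ^ 2 = (A.1 1 1 - A.1 0 0) ^ 2 + 4 * A.1 1 0 * A.1 0 1 := by rw [hs]; ring
  have hne : ∀ z : ℂ, (![z, 2 * A.1 1 0] : Fin 2 → ℂ) ≠ 0 := fun z h => by
    simpa [hA] using congrFun h 1
  refine ⟨![-(A.1 1 1 - A.1 0 0) + s, 2 * A.1 1 0], ![-(A.1 1 1 - A.1 0 0) - s, 2 * A.1 1 0],
    hne _, hne _, ?_, ?_, fun B => ?_⟩
  · rw [lineForm_eq]
    simp
    linear_combination A.1 1 0 * hs'
  · rw [lineForm_eq]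
    simp
    linear_combination A.1 1 0 * hs'
  · have hkey : lineForm B.1 ![-(A.1 1 1 - A.1 0 0) + s, 2 * A.1 1 0] *
        lineForm B.1 ![-(A.1 1 1 - A.1 0 0) - s, 2 * A.1 1 0] =
        16 * A.1 1 0 ^ 2 * ((A * B * A⁻¹ * B⁻¹).1.trace - 2) := by
      rw [trace_commutator_sub_two, lineForm_eq, lineForm_eq]
      simp only [Matrix.cons_val_zero, Matrix.cons_val_one]
      generalize A.1 1 0 = p at *
      generalize A.1 1 1 - A.1 0 0 = q at *
      generalize A.1 0 1 = r at *
      generalize B.1 1 0 = p' at *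
      generalize B.1 1 1 - B.1 0 0 = q' at *
      generalize B.1 0 1 = r' at *
      linear_combination (p' ^ 2 * (s ^ 2 - q ^ 2 + 4 * p * r) + 4 * p * p' * q' * q -
        8 * r' * p ^ 2 * p' - 4 * p ^ 2 * q' ^ 2) * hs'
    rw [← mul_eq_zero, hkey, mul_eq_zero, sub_eq_zero]
    simp [hA]

/-- A pair in `SL(2, ℂ)` without common eigenvector is conjugate to a pair in normal form. -/
theorem exists_conj_normal_form {A B : SpecialLinearGroup (Fin 2) ℂ} {b : ℂ} (hb : b ≠ 0)
    (htr : B.1.trace = b + 1 / b) (h : (A * B * A⁻¹ * B⁻¹).1.trace ≠ 2) :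
    ∃ Q : SpecialLinearGroup (Fin 2) ℂ, (∃ a : ℂ, (Q * A * Q⁻¹).1 = !![a, 1; -1, 0]) ∧
      ∃ c : ℂ, (Q * B * Q⁻¹).1 = !![b, 0; c, 1 / b] := by
  have hB := B.2
  rw [Matrix.det_fin_two] at hB
  obtain ⟨v, hv, hBv⟩ : ∃ v : Fin 2 → ℂ, v ≠ 0 ∧ B.1 *ᵥ v = (1 / b) • v := by
    have hdet : (B.1 - (1 / b) • (1 : Matrix (Fin 2) (Fin 2) ℂ)).det = 0 := by
      rw [Matrix.trace_fin_two] at htr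
      rw [Matrix.det_fin_two]
      simp
      field_simp at htr ⊢
      linear_combination b ^ 2 * hB - htr
    obtain ⟨v, hv, h0⟩ := Matrix.exists_mulVec_eq_zero_iff.mpr hdet
    refine ⟨v, hv, ?_⟩
    rw [Matrix.sub_mulVec, Matrix.smul_mulVec, Matrix.one_mulVec, sub_eq_zero] at h0
    exact h0
  have hδ : lineForm A.1 v ≠ 0 := fun h0 =>
    h (trace_commutator_eq_two_of_common hv h0 (lineForm_eq_zero_of_mulVec_eq_smul hBv))
  -- `lineForm` is quadratic, so rescaling the eigenvector by `s` normalizes its value to -1, which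
  -- gives (Au, u) determinant 1.
  obtain ⟨s, hs⟩ := IsAlgClosed.exists_eq_mul_self (-(lineForm A.1 v)⁻¹)
  obtain ⟨u, hu, hBu⟩ : ∃ u : Fin 2 → ℂ, lineForm A.1 u = -1 ∧ B.1 *ᵥ u = (1 / b) • u := by
    refine ⟨s • v, ?_, ?_⟩
    · have : lineForm A.1 (s • v) = (s * s) * lineForm A.1 v := by
        simp only [lineForm, Matrix.mulVec_smul, Pi.smul_apply, smul_eq_mul]
        ring
      rw [this, ← hs, neg_mul, inv_mul_cancel₀ hδ]
    · rw [Matrix.mulVec_smul, hBv, smul_comm]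
  set w := A.1 *ᵥ u with hw
  have hwu : w 0 * u 1 - u 0 * w 1 = 1 := by
    simp only [lineForm, ← hw] at hu
    linear_combination -hu
  -- In the basis (Au, u), the second columns of `A` and `B` are (1, 0) and (0, 1/b), since u ↦ Au
  -- and u ↦ u/b. Determinant 1 then forces the entries -1 and b in the first columns.
  let P : SpecialLinearGroup (Fin 2) ℂ := ⟨!![w 0, u 0; w 1, u 1], by
    rw [Matrix.det_fin_two_of]; exact hwu⟩
  have hw0 : A.1 0 0 * u 0 + A.1 0 1 * u 1 = w 0 := by
    rw [hw]; simp [Matrix.mulVec, dotProduct, Fin.sum_univ_two]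
  have hw1 : A.1 1 0 * u 0 + A.1 1 1 * u 1 = w 1 := by
    rw [hw]; simp [Matrix.mulVec, dotProduct, Fin.sum_univ_two]
  have hB0 : B.1 0 0 * u 0 + B.1 0 1 * u 1 = 1 / b * u 0 := by
    simpa [Matrix.mulVec, dotProduct, Fin.sum_univ_two] using congrFun hBu 0
  have hB1 : B.1 1 0 * u 0 + B.1 1 1 * u 1 = 1 / b * u 1 := by
    simpa [Matrix.mulVec, dotProduct, Fin.sum_univ_two] using congrFun hBu 1
  have hcol : ∀ X : SpecialLinearGroup (Fin 2) ℂ,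
      (P⁻¹ * X * P⁻¹⁻¹).1 0 1 = u 1 * (X.1 0 0 * u 0 + X.1 0 1 * u 1) -
        u 0 * (X.1 1 0 * u 0 + X.1 1 1 * u 1) ∧
      (P⁻¹ * X * P⁻¹⁻¹).1 1 1 = w 0 * (X.1 1 0 * u 0 + X.1 1 1 * u 1) -
        w 1 * (X.1 0 0 * u 0 + X.1 0 1 * u 1) := by
    intro X
    rw [inv_inv]
    simp only [Matrix.SpecialLinearGroup.coe_mul, Matrix.SpecialLinearGroup.coe_inv, Matrix.adjugate_fin_two]
    simp [P, Matrix.vecMul, dotProduct, Matrix.mul_apply, Fin.sum_univ_two]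
    constructor <;> ring
  refine ⟨P⁻¹, ⟨(P⁻¹ * A * P⁻¹⁻¹).1 0 0, ?_⟩, (P⁻¹ * B * P⁻¹⁻¹).1 1 0, ?_⟩
  · obtain ⟨h1, h2⟩ := hcol A
    have hd := (P⁻¹ * A * P⁻¹⁻¹).2
    rw [hw0, hw1] at h1 h2
    have h1' : (P⁻¹ * A * P⁻¹⁻¹).1 0 1 = 1 := by rw [h1]; linear_combination hwu
    have h2' : (P⁻¹ * A * P⁻¹⁻¹).1 1 1 = 0 := by rw [h2]; ring
    rw [Matrix.det_fin_two, h1', h2'] at hd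
    ext i j
    fin_cases i <;> fin_cases j
    · rfl
    · exact h1'
    · show (P⁻¹ * A * P⁻¹⁻¹).1 1 0 = -1
      linear_combination -hd
    · exact h2'
  · obtain ⟨h1, h2⟩ := hcol B
    have hd := (P⁻¹ * B * P⁻¹⁻¹).2
    rw [hB0, hB1] at h1 h2
    have h1' : (P⁻¹ * B * P⁻¹⁻¹).1 0 1 = 0 := by rw [h1]; ring
    have h2' : (P⁻¹ * B * P⁻¹⁻¹).1 1 1 = 1 / b := by rw [h2]; linear_combination (1 / b) * hwu
    rw [Matrix.det_fin_two, h1', h2'] at hd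
    ext i j
    fin_cases i <;> fin_cases j
    · show (P⁻¹ * B * P⁻¹⁻¹).1 0 0 = b
      field_simp at hd
      linear_combination hd
    · exact h1'
    · rfl
    · exact h2'

end InvariantLines

/-! ### Bases of free groups adapted to an irreducible representation -/

section AdaptedBasis

namespace FreeGroupBasis

variable {ι G : Type*} [Group G]

theorem closure_range_eq_top (S : FreeGroupBasis ι G) :
    Subgroup.closure (Set.range S) = ⊤ := by
  let H := Subgroup.closure (Set.range S)
  let φ : G →* H := S.lift fun i => ⟨S i, Subgroup.subset_closure ⟨i, rfl⟩⟩
  have h : H.subtype.comp φ = MonoidHom.id G := S.ext_hom _ _ fun i => by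
    have : φ (S i) = ⟨S i, Subgroup.subset_closure ⟨i, rfl⟩⟩ :=
      congrFun (S.lift.symm_apply_apply _) i
    simp [this]
  rw [eq_top_iff]
  intro g _
  have := DFunLike.congr_fun h g
  simp only [MonoidHom.comp_apply, MonoidHom.id_apply] at this
  rw [← this]
  exact (φ g).2

theorem lift_basis {H : Type*} [Group H] (S : FreeGroupBasis ι G) (f : ι → H) (i : ι) :
    S.lift f (S i) = f i :=
  congrFun (S.lift.symm_apply_apply f) i

/-- Right multiplication of a basis element by a power of another one. -/
theorem exists_transvection [DecidableEq ι] (S : FreeGroupBasis ι G) {i j : ι} (hij : i ≠ j)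
    (m : ℤ) : ∃ S' : FreeGroupBasis ι G, (∀ l, l ≠ j → S' l = S l) ∧ S' j = S j * S i ^ m := by
  let φ : ℤ → G →* G := fun m => S.lift (Function.update S j (S j * S i ^ m))
  have h1 : ∀ m l, l ≠ j → φ m (S l) = S l := fun m l hl => by
    simp only [φ, lift_basis, Function.update_of_ne hl]
  have h2 : ∀ m, φ m (S j) = S j * S i ^ m := fun m => by
    simp only [φ, lift_basis, Function.update_self]
  have h3 : ∀ m, (φ (-m)).comp (φ m) = MonoidHom.id G := fun m => S.ext_hom _ _ fun l => by
    rcases eq_or_ne l j with rfl | hl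
    · simp [h2, h1 _ _ hij]
    · simp [h1 _ _ hl]
  have h4 := h3 (-m)
  rw [neg_neg] at h4
  refine ⟨S.map ((φ m).toMulEquiv (φ (-m)) (h3 m) h4), fun l hl => ?_, ?_⟩
  · simpa using h1 m l hl
  · simpa using h2 m

end FreeGroupBasis

open Matrix

variable {ι F : Type*} [Group F]

/-- An irreducible representation leaves no line invariant. -/
theorem SL2Rep.IsIrreducible.exists_lineForm_ne_zero {ρ : SL2Rep F} (hρ : ρ.IsIrreducible)
    (S : FreeGroupBasis ι F) {v : Fin 2 → ℂ} (hv : v ≠ 0) :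
    ∃ i, lineForm (ρ (S i)).1 v ≠ 0 := by
  by_contra! hall
  let H : Subgroup F :=
    { carrier := {g | ∃ μ : ℂ, (ρ g).1 *ᵥ v = μ • v}
      one_mem' := ⟨1, by rw [map_one, Matrix.SpecialLinearGroup.coe_one]; simp⟩
      mul_mem' := by
        rintro a b ⟨x, hx⟩ ⟨y, hy⟩
        refine ⟨y * x, ?_⟩
        rw [map_mul, Matrix.SpecialLinearGroup.coe_mul, ← Matrix.mulVec_mulVec, hy,
          Matrix.mulVec_smul, hx, smul_smul]
      inv_mem' := by
        rintro a ⟨x, hx⟩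
        have hx0 := eigenvalue_ne_zero_of_det_eq_one (ρ a).2 hv hx
        refine ⟨x⁻¹, ?_⟩
        have h1 : (ρ a⁻¹).1 *ᵥ ((ρ a).1 *ᵥ v) = v := by
          rw [Matrix.mulVec_mulVec, ← Matrix.SpecialLinearGroup.coe_mul, ← map_mul,
            inv_mul_cancel, map_one, Matrix.SpecialLinearGroup.coe_one, Matrix.one_mulVec]
        rw [hx, Matrix.mulVec_smul] at h1
        rw [eq_inv_smul_iff₀ hx0, h1] }
  have hH : H = ⊤ := by
    rw [eq_top_iff, ← S.closure_range_eq_top, Subgroup.closure_le]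
    rintro _ ⟨i, rfl⟩
    exact exists_mulVec_eq_smul_of_lineForm_eq_zero hv (hall i)
  let N : Subrepresentation ρ.toRepresentation :=
    { toSubmodule := Submodule.span ℂ {v}
      apply_mem_toSubmodule := by
        intro g w hw
        obtain ⟨c, rfl⟩ := Submodule.mem_span_singleton.mp hw
        obtain ⟨μ, hμ⟩ : g ∈ H := hH ▸ Subgroup.mem_top g
        refine Submodule.mem_span_singleton.mpr ⟨c * μ, ?_⟩
        have : ρ.toRepresentation g (c • v) = (ρ g).1 *ᵥ (c • v) := rfl
        rw [this, Matrix.mulVec_smul, hμ, smul_smul] }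
  have : IsSimpleOrder (Subrepresentation ρ.toRepresentation) := hρ
  rcases IsSimpleOrder.eq_bot_or_eq_top N with h | h
  · have h1 : v ∈ N := Submodule.mem_span_singleton_self v
    rw [h] at h1
    exact hv h1
  · have h1 : ∀ w : Fin 2 → ℂ, w ∈ Submodule.span ℂ {v} := fun w => by
      have : w ∈ N := by rw [h]; trivial
      exact this
    obtain ⟨c, hc⟩ := Submodule.mem_span_singleton.mp (h1 ![1, 0])
    obtain ⟨d, hd⟩ := Submodule.mem_span_singleton.mp (h1 ![0, 1])
    have hc0 : c * v 0 = 1 := by simpa using congrFun hc 0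
    have hc1 : c * v 1 = 0 := by simpa using congrFun hc 1
    have hd0 : d * v 0 = 0 := by simpa using congrFun hd 0
    have hd1 : d * v 1 = 1 := by simpa using congrFun hd 1
    have : (1 : ℂ) = 0 := by linear_combination (-d * v 1) * hc0 - hd1 + (c * v 1) * hd0
    exact one_ne_zero this

/-- Some basis contains a pair on which an irreducible representation is irreducible. -/
theorem exists_basis_trace_commutator_ne_two [DecidableEq ι] {ρ : SL2Rep F}
    (hρ : ρ.IsIrreducible) (S : FreeGroupBasis ι F) :
    ∃ (S' : FreeGroupBasis ι F) (i j : ι), i ≠ j ∧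
      (ρ (S' i) * ρ (S' j) * (ρ (S' i))⁻¹ * (ρ (S' j))⁻¹).1.trace ≠ 2 := by
  -- Moving the line of (1, 0) means having a nonzero lower left entry, as the quadratic formula for
  -- the eigenvectors requires.
  obtain ⟨i, hi⟩ := hρ.exists_lineForm_ne_zero S (v := ![1, 0]) (fun h => by
    simpa using congrFun h 0)
  have hi' : (ρ (S i)).1 1 0 ≠ 0 := by
    rw [lineForm_eq] at hi
    simpa using hi
  obtain ⟨v, w, hv, hw, hAv, hAw, hA⟩ := exists_lineForm_mul_lineForm hi'
  obtain ⟨j, hj⟩ := hρ.exists_lineForm_ne_zero S hv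
  obtain ⟨l, hl⟩ := hρ.exists_lineForm_ne_zero S hw
  have hij : i ≠ j := by rintro rfl; exact hj hAv
  have hil : i ≠ l := by rintro rfl; exact hl hAw
  by_cases hj2 : (ρ (S i) * ρ (S j) * (ρ (S i))⁻¹ * (ρ (S j))⁻¹).1.trace = 2
  swap
  · exact ⟨S, i, j, hij, hj2⟩
  by_cases hl2 : (ρ (S i) * ρ (S l) * (ρ (S i))⁻¹ * (ρ (S l))⁻¹).1.trace = 2
  swap
  · exact ⟨S, i, l, hil, hl2⟩
  have hjw := ((hA _).mp hj2).resolve_left hj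
  have hlv := ((hA _).mp hl2).resolve_right hl
  have hlj : l ≠ j := by rintro rfl; exact hl hjw
  -- Here `S j` moves `v` but fixes the line of `w`, and `S l` does the opposite; their product
  -- moves both lines.
  obtain ⟨S', h1, h2⟩ := S.exists_transvection hlj 1
  refine ⟨S', i, j, hij, ?_⟩
  rw [h1 i hij, h2, zpow_one, map_mul, Ne, hA, Matrix.SpecialLinearGroup.coe_mul, not_or]
  exact ⟨lineForm_mul_ne_zero_of_right (ρ (S l)).2 hv hj hlv,
    lineForm_mul_ne_zero_of_left (ρ (S j)).2 hw hjw hl⟩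

/-- If `A, B ∈ SL(2, ℂ)` and `A`, `B`, `A * B`, `B * A⁻¹` all have trace `±2`, then the
commutator of `A` and `B` has trace `2`. -/
theorem trace_commutator_eq_two_of_trace_sq {A B : SpecialLinearGroup (Fin 2) ℂ}
    (hA : A.1.trace ^ 2 = 4) (hB : B.1.trace ^ 2 = 4) (hAB : (A * B).1.trace ^ 2 = 4)
    (hBA : (B * A⁻¹).1.trace ^ 2 = 4) : (A * B * A⁻¹ * B⁻¹).1.trace = 2 := by
  rw [trace_mul_inv] at hBA
  rw [trace_commutator, hA, hB, hAB]
  -- With x, y, z the traces of A, B, AB, the condition (xy - z)² = 4 reads 16 - 2xyz + 4 = 4.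
  have : A.1.trace * B.1.trace * (A * B).1.trace = 8 := by
    have h : (A.1.trace * B.1.trace) ^ 2 = 16 := by rw [mul_pow, hA, hB]; norm_num
    linear_combination (h + hAB - hBA) / 2
  linear_combination -this

/-- An irreducible representation of a free group of rank at least two is irreducible on the
first two elements of some basis, the second of which has trace different from `±2`. -/
theorem exists_adapted_basis {k : ℕ} (hk : 2 ≤ k) {ρ : SL2Rep F} (hρ : ρ.IsIrreducible)
    (S : FreeGroupBasis (Fin k) F) :
    ∃ S' : FreeGroupBasis (Fin k) F,
      ρ.character (S' ⟨0, by omega⟩ * S' ⟨1, by omega⟩ * (S' ⟨0, by omega⟩)⁻¹ *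
        (S' ⟨1, by omega⟩)⁻¹) ≠ 2 ∧ ρ.character (S' ⟨1, by omega⟩) ^ 2 ≠ 4 := by
  suffices h : ∃ (S' : FreeGroupBasis (Fin k) F) (i j : Fin k), i ≠ j ∧
      (ρ (S' i) * ρ (S' j) * (ρ (S' i))⁻¹ * (ρ (S' j))⁻¹).1.trace ≠ 2 ∧
      (ρ (S' j)).1.trace ^ 2 ≠ 4 by
    obtain ⟨S', i, j, hij, h1, h2⟩ := h
    have h01 : (⟨0, by omega⟩ : Fin k) ≠ ⟨1, by omega⟩ := by simp
    obtain ⟨e, he0, he1⟩ : ∃ e : Equiv.Perm (Fin k), e ⟨0, by omega⟩ = i ∧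
        e ⟨1, by omega⟩ = j := by
      let e₁ := Equiv.swap (⟨0, by omega⟩ : Fin k) i
      refine ⟨e₁.trans (Equiv.swap (e₁ ⟨1, by omega⟩) j), ?_, ?_⟩
      · have : e₁ ⟨0, by omega⟩ = i := Equiv.swap_apply_left _ _
        rw [Equiv.trans_apply, this, Equiv.swap_apply_of_ne_of_ne _ hij]
        rw [← this]
        exact fun h => h01 (e₁.injective h)
      · rw [Equiv.trans_apply, Equiv.swap_apply_left]
    refine ⟨S'.reindex e.symm, ?_, ?_⟩
    · simpa [SL2Rep.character, he0, he1] using h1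
    · simpa [SL2Rep.character, he1] using h2
  obtain ⟨S, i, j, hij, h⟩ := exists_basis_trace_commutator_ne_two hρ S
  -- One of B, A, AB, BA⁻¹ has trace other than ±2. The moves to (B, A), (A, BA), (A, BA⁻¹) bring
  -- it, or a conjugate, into second place; they invert or preserve the commutator, so its trace
  -- stays the same.
  by_cases hB : (ρ (S j)).1.trace ^ 2 = 4
  swap
  · exact ⟨S, i, j, hij, h, hB⟩
  by_cases hA : (ρ (S i)).1.trace ^ 2 = 4
  swap
  · refine ⟨S, j, i, hij.symm, ?_, hA⟩
    rw [← trace_inv] at h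
    convert! h using 3
    group
  by_cases hAB : (ρ (S i) * ρ (S j)).1.trace ^ 2 = 4
  swap
  · obtain ⟨S', h1, h2⟩ := S.exists_transvection hij 1
    refine ⟨S', i, j, hij, ?_, ?_⟩
    · rw [h1 i hij, h2, zpow_one, map_mul]
      convert! h using 3
      group
    · rw [h2, zpow_one, map_mul, Matrix.SpecialLinearGroup.coe_mul, Matrix.trace_mul_comm,
        ← Matrix.SpecialLinearGroup.coe_mul]
      exact hAB
  by_cases hBA : (ρ (S j) * (ρ (S i))⁻¹).1.trace ^ 2 = 4
  swap
  · obtain ⟨S', h1, h2⟩ := S.exists_transvection hij (-1)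
    refine ⟨S', i, j, hij, ?_, ?_⟩
    · rw [h1 i hij, h2, _root_.zpow_neg_one, map_mul, map_inv]
      convert! h using 3
      group
    · rw [h2, _root_.zpow_neg_one, map_mul, map_inv]
      exact hBA
  exact absurd (trace_commutator_eq_two_of_trace_sq hA hB hAB hBA) h

end AdaptedBasis

/-! ### Smooth reconstruction of a good representation from its traces -/

section Reconstruction

open Matrix

/-- A smooth local branch of the solution `b` of `b + 1 / b = t`. -/
theorem exists_add_inv_branch {b₀ : ℂ} (h0 : b₀ ≠ 0) (h1 : b₀ ≠ 1) (h2 : b₀ ≠ -1) :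
    ∃ (B T : Set ℂ) (φ : ℂ → ℂ), IsOpen B ∧ IsOpen T ∧ b₀ ∈ B ∧ ContDiffOn ℝ ∞ φ T ∧
      (∀ t ∈ T, φ t ∈ B ∧ φ t + 1 / φ t = t) ∧ (∀ b ∈ B, b + 1 / b ∈ T ∧ φ (b + 1 / b) = b) ∧
      ∀ b ∈ B, b ≠ 0 ∧ b ≠ 1 ∧ b ≠ -1 := by
  let f : ℂ → ℂ := fun b => b + 1 / b
  have hf : ∀ b : ℂ, b ≠ 0 → ContDiffAt ℂ ∞ f b := fun b hb =>
    contDiffAt_id.add (contDiffAt_const.div contDiffAt_id hb)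
  have hd : ∀ b : ℂ, b ≠ 0 → HasDerivAt f (1 - 1 / b ^ 2) b := fun b hb => by
    have := (hasDerivAt_id b).add (hasDerivAt_inv hb)
    convert! this using 1
    · ext x; simp [f]
    · ring
  have hne : ∀ b : ℂ, b ≠ 0 → b ≠ 1 → b ≠ -1 → (1 - 1 / b ^ 2 : ℂ) ≠ 0 := by
    intro b hb hb1 hb2 h
    field_simp at h
    have : (b - 1) * (b + 1) = 0 := by linear_combination h
    rcases mul_eq_zero.mp this with h | h
    · exact hb1 (sub_eq_zero.mp h)
    · exact hb2 (eq_neg_of_add_eq_zero_left h)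
  have hd0 := (hd b₀ h0).hasFDerivAt_equiv (hne b₀ h0 h1 h2)
  let Ψ := (hf b₀ h0).toOpenPartialHomeomorph f hd0 (by simp)
  have hΨ : (Ψ : ℂ → ℂ) = f := (hf b₀ h0).toOpenPartialHomeomorph_coe hd0 (by simp)
  have hbΨ : b₀ ∈ Ψ.source := (hf b₀ h0).mem_toOpenPartialHomeomorph_source hd0 (by simp)
  have hopen : IsOpen ({0, 1, -1}ᶜ : Set ℂ) :=
    (Set.Finite.isClosed (by simp)).isOpen_compl
  let Φ := Ψ.restrOpen _ hopen
  have hΦ : (Φ : ℂ → ℂ) = f := hΨ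
  have hsrc : ∀ b ∈ Φ.source, b ≠ 0 ∧ b ≠ 1 ∧ b ≠ -1 := fun b hb => by
    simpa using hb.2
  refine ⟨Φ.source, Φ.target, Φ.symm, Φ.open_source, Φ.open_target, ⟨hbΨ, by simp [*]⟩,
    ?_, ?_, ?_, hsrc⟩
  · intro t ht
    obtain ⟨h3, h4, h5⟩ := hsrc _ (Φ.map_target ht)
    have h : ContDiffAt ℂ ∞ Φ.symm t := by
      refine Φ.contDiffAt_symm_deriv (hne _ h3 h4 h5) ht ?_ ?_
      · rw [hΦ]; exact hd _ h3
      · rw [hΦ]; exact hf _ h3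
    exact (h.restrict_scalars ℝ).contDiffWithinAt
  · intro t ht
    refine ⟨Φ.map_target ht, ?_⟩
    have := Φ.right_inv ht
    rwa [hΦ] at this
  · intro b hb
    have h3 := Φ.map_source hb
    have h4 := Φ.left_inv hb
    rw [hΦ] at h3 h4
    exact ⟨h3, h4⟩

/-- The principal branch of `z ↦ z ^ (-1 / 2)`. -/
noncomputable def invSqrt (z : ℂ) : ℂ := Complex.exp (-Complex.log z / 2)

theorem invSqrt_sq_mul {z : ℂ} (hz : z ≠ 0) : invSqrt z ^ 2 * z = 1 := by
  have h : invSqrt z ^ 2 = (Complex.exp (Complex.log z))⁻¹ := by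
    rw [invSqrt, ← Complex.exp_nat_mul, ← Complex.exp_neg]
    congr 1
    push_cast
    ring
  rw [h, Complex.exp_log hz, inv_mul_cancel₀ hz]

theorem invSqrt_one : invSqrt 1 = 1 := by simp [invSqrt]

theorem contDiffOn_invSqrt : ContDiffOn ℝ ∞ invSqrt Complex.slitPlane := by
  intro z hz
  have h : ContDiffAt ℂ ∞ invSqrt z :=
    Complex.contDiff_exp.contDiffAt.comp z ((Complex.contDiffAt_log hz).neg.div_const 2)
  exact (h.restrict_scalars ℝ).contDiffWithinAt

/-- The value of `tr [A, B] - 2` for `A = !![a, 1; -1, 0]` and `B = !![b, 0; c, 1 / b]`. -/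
noncomputable def pairDisc (a b c : ℂ) : ℂ :=
  (b - b⁻¹) ^ 2 + c ^ 2 + a * c * (b - b⁻¹)

theorem trace_commutator_normal_form {A B : SpecialLinearGroup (Fin 2) ℂ} {a b c : ℂ}
    (hA : A.1 = !![a, 1; -1, 0]) (hB : B.1 = !![b, 0; c, 1 / b]) :
    (A * B * A⁻¹ * B⁻¹).1.trace - 2 = pairDisc a b c := by
  rw [trace_commutator_sub_two, hA, hB]
  simp [pairDisc]
  ring

/-- The matrix `M` with given traces of `M`, `A * M`, `B * M`, `A * B * M`, where
`A = !![a, 1; -1, 0]` and `B = !![b, 0; c, 1 / b]`. -/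
noncomputable def matrixOfTraces (a b c t₀ t₁ t₂ t₃ : ℂ) : Matrix (Fin 2) (Fin 2) ℂ :=
  !![((b - b⁻¹) * (t₂ - t₀ * b⁻¹) + c * (t₃ - t₁ * b⁻¹)) * (pairDisc a b c)⁻¹,
    ((a * (b - b⁻¹) + c) * (t₂ - t₀ * b⁻¹) - (b - b⁻¹) * (t₃ - t₁ * b⁻¹)) * (pairDisc a b c)⁻¹;
    t₁ - a * (((b - b⁻¹) * (t₂ - t₀ * b⁻¹) + c * (t₃ - t₁ * b⁻¹)) * (pairDisc a b c)⁻¹) +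
      ((a * (b - b⁻¹) + c) * (t₂ - t₀ * b⁻¹) - (b - b⁻¹) * (t₃ - t₁ * b⁻¹)) *
        (pairDisc a b c)⁻¹,
    t₀ - ((b - b⁻¹) * (t₂ - t₀ * b⁻¹) + c * (t₃ - t₁ * b⁻¹)) * (pairDisc a b c)⁻¹]

/-- Subtracting b⁻¹ times the traces of M and AM from those of BM and ABM eliminates the lower row
of M. What remains is a 2 × 2 system for the upper row, of determinant `-pairDisc a b c`. -/
theorem matrixOfTraces_eq {a b c : ℂ} (hD : pairDisc a b c ≠ 0)
    {A B : Matrix (Fin 2) (Fin 2) ℂ} (hA : A = !![a, 1; -1, 0]) (hB : B = !![b, 0; c, 1 / b])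
    (M : Matrix (Fin 2) (Fin 2) ℂ) :
    matrixOfTraces a b c M.trace (A * M).trace (B * M).trace (A * B * M).trace = M := by
  have h1 : (B * M).trace - M.trace * b⁻¹ = (b - b⁻¹) * M 0 0 + c * M 0 1 := by
    rw [hB]
    simp [Matrix.trace_fin_two, Matrix.vecMul, dotProduct]
    ring
  have h2 : (A * B * M).trace - (A * M).trace * b⁻¹ =
      (a * (b - b⁻¹) + c) * M 0 0 - (b - b⁻¹) * M 0 1 := by
    rw [hA, hB]
    simp [Matrix.trace_fin_two, Matrix.vecMul, dotProduct]
    ring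
  have h3 : (A * M).trace = a * M 0 0 + M 1 0 - M 0 1 := by
    rw [hA]
    simp [Matrix.trace_fin_two, Matrix.vecMul, dotProduct]
    ring
  have hp : ((b - b⁻¹) * ((B * M).trace - M.trace * b⁻¹) +
      c * ((A * B * M).trace - (A * M).trace * b⁻¹)) * (pairDisc a b c)⁻¹ = M 0 0 := by
    rw [h1, h2, mul_inv_eq_iff_eq_mul₀ hD, pairDisc]
    ring
  have hq : ((a * (b - b⁻¹) + c) * ((B * M).trace - M.trace * b⁻¹) -
      (b - b⁻¹) * ((A * B * M).trace - (A * M).trace * b⁻¹)) * (pairDisc a b c)⁻¹ = M 0 1 := by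
    rw [h1, h2, mul_inv_eq_iff_eq_mul₀ hD, pairDisc]
    ring
  rw [matrixOfTraces, hp, hq, h3, Matrix.trace_fin_two]
  ext i j
  fin_cases i <;> fin_cases j <;> simp
  ring

section Smooth

variable {E : Type*} [NormedAddCommGroup E] [NormedSpace ℝ E] {O : Set E}
  {a b c t₀ t₁ t₂ t₃ : E → ℂ}

theorem ContDiffOn.pairDisc (ha : ContDiffOn ℝ ∞ a O) (hb : ContDiffOn ℝ ∞ b O)
    (hc : ContDiffOn ℝ ∞ c O) (hb0 : ∀ x ∈ O, b x ≠ 0) :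
    ContDiffOn ℝ ∞ (fun x => pairDisc (a x) (b x) (c x)) O := by
  have hbi := hb.inv hb0
  unfold _root_.pairDisc
  exact (((hb.sub hbi).pow 2).add (hc.pow 2)).add ((ha.mul hc).mul (hb.sub hbi))

theorem ContDiffOn.matrixOfTraces (ha : ContDiffOn ℝ ∞ a O) (hb : ContDiffOn ℝ ∞ b O)
    (hc : ContDiffOn ℝ ∞ c O) (h₀ : ContDiffOn ℝ ∞ t₀ O) (h₁ : ContDiffOn ℝ ∞ t₁ O)
    (h₂ : ContDiffOn ℝ ∞ t₂ O) (h₃ : ContDiffOn ℝ ∞ t₃ O) (hb0 : ∀ x ∈ O, b x ≠ 0)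
    (hD : ∀ x ∈ O, _root_.pairDisc (a x) (b x) (c x) ≠ 0) (i j : Fin 2) :
    ContDiffOn ℝ ∞ (fun x => matrixOfTraces (a x) (b x) (c x) (t₀ x) (t₁ x) (t₂ x) (t₃ x) i j)
      O := by
  have hbi := hb.inv hb0
  have hDi := (ContDiffOn.pairDisc ha hb hc hb0).inv hD
  have he := hb.sub hbi
  have hu := h₂.sub (h₀.mul hbi)
  have hv := h₃.sub (h₁.mul hbi)
  have hp := ((he.mul hu).add (hc.mul hv)).mul hDi
  have hq := ((((ha.mul he).add hc).mul hu).sub (he.mul hv)).mul hDi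
  fin_cases i <;> fin_cases j
  · exact hp
  · exact hq
  · exact (h₁.sub (ha.mul hp)).add hq
  · exact h₀.sub hp

end Smooth

end Reconstruction

/-! ### Characters as smooth coordinates -/

section Coordinates

open Matrix

variable {F : Type*} [Group F] {k n : ℕ}

/-- Traces are smooth functions of trace coordinates. -/
theorem IsTraceCoordinateSystem.exists_contDiff {γ : Fin n → F}
    (hγ : IsTraceCoordinateSystem γ) (g : F) :
    ∃ h : (Fin n → ℂ) → ℂ, ContDiff ℝ ∞ h ∧
      ∀ ρ : SL2Rep F, h (traceCoords γ ρ.character) = ρ.character g := by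
  suffices H : ∀ f : SL2Rep F → ℂ, f ∈ Algebra.adjoin ℂ (Set.range fun i : Fin n =>
      fun ρ : SL2Rep F => ρ.character (γ i)) → ∃ h : (Fin n → ℂ) → ℂ, ContDiff ℝ ∞ h ∧
        ∀ ρ : SL2Rep F, h (traceCoords γ ρ.character) = f ρ from H _ (hγ g)
  intro f hf
  induction hf using Algebra.adjoin_induction with
  | mem f hf =>
    obtain ⟨i, rfl⟩ := hf
    exact ⟨fun x => x i, contDiff_apply ℝ ℂ i, fun ρ => rfl⟩
  | algebraMap r => exact ⟨fun _ => r, contDiff_const, fun ρ => rfl⟩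
  | add f₁ f₂ _ _ ih₁ ih₂ =>
    obtain ⟨h₁, hs₁, he₁⟩ := ih₁
    obtain ⟨h₂, hs₂, he₂⟩ := ih₂
    exact ⟨fun x => h₁ x + h₂ x, hs₁.add hs₂, fun ρ => by simp [he₁, he₂]⟩
  | mul f₁ f₂ _ _ ih₁ ih₂ =>
    obtain ⟨h₁, hs₁, he₁⟩ := ih₁
    obtain ⟨h₂, hs₂, he₂⟩ := ih₂
    exact ⟨fun x => h₁ x * h₂ x, hs₁.mul hs₂, fun ρ => by simp [he₁, he₂]⟩

/-- The matrix entries of `ρ g` are smooth functions of the coordinates of `ρ`. -/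
theorem exists_contDiff_entries (S : FreeGroupBasis (Fin k) F) (g : F) :
    ∃ w : (Fin k → Fin 2 → Fin 2 → ℂ) → Fin 2 → Fin 2 → ℂ,
      (∀ i j, ContDiff ℝ ∞ fun m => w m i j) ∧
      ∀ (ρ : SL2Rep F) (i j : Fin 2), w (repCoords S ρ) i j = (ρ g).1 i j := by
  have hg : g ∈ Subgroup.closure (Set.range S) := by
    rw [S.closure_range_eq_top]; exact Subgroup.mem_top g
  induction hg using Subgroup.closure_induction with
  | mem g hg =>
    obtain ⟨l, rfl⟩ := hg
    exact ⟨fun m => m l, fun i j => by fun_prop, fun ρ i j => rfl⟩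
  | one =>
    refine ⟨fun _ i j => (1 : Matrix (Fin 2) (Fin 2) ℂ) i j, fun i j => contDiff_const,
      fun ρ i j => ?_⟩
    rw [map_one, Matrix.SpecialLinearGroup.coe_one]
  | mul x y _ _ ihx ihy =>
    obtain ⟨w₁, hs₁, he₁⟩ := ihx
    obtain ⟨w₂, hs₂, he₂⟩ := ihy
    refine ⟨fun m i j => w₁ m i 0 * w₂ m 0 j + w₁ m i 1 * w₂ m 1 j, fun i j =>
      ((hs₁ i 0).mul (hs₂ 0 j)).add ((hs₁ i 1).mul (hs₂ 1 j)), fun ρ i j => ?_⟩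
    rw [map_mul, Matrix.SpecialLinearGroup.coe_mul, Matrix.mul_apply, Fin.sum_univ_two]
    simp only [he₁, he₂]
  | inv x _ ih =>
    obtain ⟨w, hs, he⟩ := ih
    refine ⟨fun m => !![w m 1 1, -w m 0 1; -w m 1 0, w m 0 0], fun i j => ?_, fun ρ i j => ?_⟩
    · fin_cases i <;> fin_cases j
      · exact hs 1 1
      · exact (hs 0 1).neg
      · exact (hs 1 0).neg
      · exact hs 0 0
    · rw [map_inv, Matrix.SpecialLinearGroup.coe_inv, Matrix.adjugate_fin_two]
      simp only [he]

/-- The trace coordinates of a representation are smooth functions of its coordinates. -/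
theorem exists_contDiff_traceCoords (S : FreeGroupBasis (Fin k) F) (γ : Fin n → F) :
    ∃ T : (Fin k → Fin 2 → Fin 2 → ℂ) → Fin n → ℂ, ContDiff ℝ ∞ T ∧
      ∀ ρ : SL2Rep F, T (repCoords S ρ) = traceCoords γ ρ.character := by
  choose w hs he using fun i => exists_contDiff_entries S (γ i)
  refine ⟨fun m i => w i m 0 0 + w i m 1 1,
    contDiff_pi.mpr fun i => (hs i 0 0).add (hs i 1 1), fun ρ => ?_⟩
  funext i
  simp only [he]
  exact (Matrix.trace_fin_two _).symm

/-- On good representations whose second matrix has its eigenvalue in the domain of a branch of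
the solution of `b + 1 / b = t`, the coordinates are smooth functions of the character. -/
theorem exists_smooth_inverse (hk : 2 ≤ k) (S : FreeGroupBasis (Fin k) F) {γ : Fin n → F}
    (hγ : IsTraceCoordinateSystem γ) {B T : Set ℂ} {φ : ℂ → ℂ} (hT : IsOpen T)
    (hφ : ContDiffOn ℝ ∞ φ T) (hφT : ∀ t ∈ T, φ t ∈ B ∧ φ t + 1 / φ t = t)
    (hφB : ∀ b ∈ B, b + 1 / b ∈ T ∧ φ (b + 1 / b) = b)
    (hB : ∀ b ∈ B, b ≠ 0 ∧ b ≠ 1 ∧ b ≠ -1) :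
    ∃ (O : Set (Fin n → ℂ)) (r : (Fin n → ℂ) → Fin k → Fin 2 → Fin 2 → ℂ),
      IsOpen O ∧ ContDiffOn ℝ ∞ r O ∧
      (∀ x ∈ O, ∃ ρ ∈ goodRepresentations hk S, repCoords S ρ = r x ∧
        (ρ (S ⟨1, by omega⟩)).1 0 0 ∈ B) ∧
      ∀ ρ ∈ goodRepresentations hk S, (ρ (S ⟨1, by omega⟩)).1 0 0 ∈ B →
        traceCoords γ ρ.character ∈ O ∧ r (traceCoords γ ρ.character) = repCoords S ρ := by
  -- `h g` is defined on all of ℂⁿ but is the trace of `g` only on characters; off them the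
  -- identities between traces may fail.
  choose h hs he using hγ.exists_contDiff
  set i₀ : Fin k := ⟨0, by omega⟩ with hi₀
  set i₁ : Fin k := ⟨1, by omega⟩ with hi₁
  have hi : i₁ ≠ i₀ := by simp [hi₀, hi₁]
  let a : (Fin n → ℂ) → ℂ := h (S i₀)
  let b : (Fin n → ℂ) → ℂ := fun x => φ (h (S i₁) x)
  let c : (Fin n → ℂ) → ℂ := fun x => h (S i₀ * S i₁) x - a x * b x
  let R : Fin k → (Fin n → ℂ) → Matrix (Fin 2) (Fin 2) ℂ := fun i x =>
    matrixOfTraces (a x) (b x) (c x) (h (S i) x) (h (S i₀ * S i) x) (h (S i₁ * S i) x)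
      (h (S i₀ * S i₁ * S i) x)
  -- Off the character variety `R i x` need not have determinant 1. Rescaling by an inverse square
  -- root of the determinant repairs this and changes nothing on characters in play, where the
  -- determinant is already 1.
  let r : (Fin n → ℂ) → Fin k → Matrix (Fin 2) (Fin 2) ℂ := fun x i =>
    if i = i₀ then !![a x, 1; -1, 0] else if i = i₁ then !![b x, 0; c x, 1 / b x] else
      invSqrt (R i x).det • R i x
  let O₁ : Set (Fin n → ℂ) := h (S i₁) ⁻¹' T
  have hO₁ : IsOpen O₁ := hT.preimage (hs _).continuous
  have ha : ContDiffOn ℝ ∞ a O₁ := (hs _).contDiffOn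
  have hb : ContDiffOn ℝ ∞ b O₁ := hφ.comp (hs _).contDiffOn fun x hx => hx
  have hc : ContDiffOn ℝ ∞ c O₁ := (hs _).contDiffOn.sub (ha.mul hb)
  have hb0 : ∀ x ∈ O₁, b x ≠ 0 := fun x hx => (hB _ (hφT _ hx).1).1
  let O₂ : Set (Fin n → ℂ) := O₁ ∩ (fun x => pairDisc (a x) (b x) (c x)) ⁻¹' {0}ᶜ
  have hO₂ : IsOpen O₂ := (ContDiffOn.pairDisc ha hb hc hb0).continuousOn.isOpen_inter_preimage
    hO₁ isOpen_compl_singleton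
  have h21 : O₂ ⊆ O₁ := Set.inter_subset_left
  have hR : ∀ l i j, ContDiffOn ℝ ∞ (fun x => R l x i j) O₂ := fun l i j =>
    ContDiffOn.matrixOfTraces (ha.mono h21) (hb.mono h21) (hc.mono h21) (hs _).contDiffOn
      (hs _).contDiffOn (hs _).contDiffOn (hs _).contDiffOn (fun x hx => hb0 x hx.1)
      (fun x hx => hx.2) i j
  have hdet : ∀ l, ContDiffOn ℝ ∞ (fun x => (R l x).det) O₂ := fun l => by
    simp only [Matrix.det_fin_two]
    exact ((hR l 0 0).mul (hR l 1 1)).sub ((hR l 0 1).mul (hR l 1 0))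
  let O : Set (Fin n → ℂ) := ⋂ l, O₂ ∩ (fun x => (R l x).det) ⁻¹' Complex.slitPlane
  have hO : IsOpen O := isOpen_iInter_of_finite fun l =>
    (hdet l).continuousOn.isOpen_inter_preimage hO₂ Complex.isOpen_slitPlane
  have hO2 : O ⊆ O₂ := fun x hx => (Set.mem_iInter.mp hx i₀).1
  have hOs : ∀ l, ∀ x ∈ O, (R l x).det ∈ Complex.slitPlane :=
    fun l x hx => (Set.mem_iInter.mp hx l).2
  refine ⟨O, fun x i p q => r x i p q, hO, ?_, ?_, ?_⟩
  · refine contDiffOn_pi.mpr fun i => contDiffOn_pi.mpr fun p => contDiffOn_pi.mpr fun q => ?_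
    have ha' := ha.mono (hO2.trans h21)
    have hb' := hb.mono (hO2.trans h21)
    have hc' := hc.mono (hO2.trans h21)
    by_cases h0 : i = i₀
    · simp only [r, if_pos h0]
      fin_cases p <;> fin_cases q
      · exact ha'
      · exact contDiffOn_const
      · exact contDiffOn_const
      · exact contDiffOn_const
    by_cases h1 : i = i₁
    · simp only [r, if_neg h0, if_pos h1]
      fin_cases p <;> fin_cases q
      · exact hb'
      · exact contDiffOn_const
      · exact hc'
      · simp only [one_div]
        exact hb'.inv fun x hx => hb0 x (h21 (hO2 hx))
    · simp only [r, if_neg h0, if_neg h1, Matrix.smul_apply, smul_eq_mul]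
      exact (contDiffOn_invSqrt.comp ((hdet i).mono hO2) (hOs i)).mul ((hR i p q).mono hO2)
  · intro x hx
    have hr₀ : r x i₀ = !![a x, 1; -1, 0] := by simp [r]
    have hr₁ : r x i₁ = !![b x, 0; c x, 1 / b x] := by simp [r, hi]
    have hbx := hB _ (hφT _ (h21 (hO2 hx))).1
    have hrdet : ∀ i, (r x i).det = 1 := by
      intro i
      by_cases h0 : i = i₀
      · rw [h0, hr₀, Matrix.det_fin_two_of]; ring
      by_cases h1 : i = i₁
      · rw [h1, hr₁, Matrix.det_fin_two_of]
        field_simp [hb0 x (h21 (hO2 hx))]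
        simp
      · simp only [r, if_neg h0, if_neg h1]
        rw [Matrix.det_smul, Fintype.card_fin]
        exact invSqrt_sq_mul (Complex.slitPlane_ne_zero (hOs i x hx))
    let ρ : SL2Rep F := S.lift fun i => ⟨r x i, hrdet i⟩
    have hρ : ∀ i, (ρ (S i)).1 = r x i := fun i => by
      have h : ρ (S i) = ⟨r x i, hrdet i⟩ := S.lift_basis _ i
      rw [h]
    refine ⟨ρ, ⟨⟨a x, ?_⟩, ⟨b x, c x, hbx.1, hbx.2.1, hbx.2.2, ?_⟩, ?_⟩, ?_, ?_⟩
    · rw [← hr₀]; exact hρ i₀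
    · rw [← hr₁]; exact hρ i₁
    · have := trace_commutator_normal_form ((hρ i₀).trans hr₀) ((hρ i₁).trans hr₁)
      rw [← sub_ne_zero]
      simp only [SL2Rep.character, map_mul, map_inv]
      rw [this]
      exact (hO2 hx).2
    · funext i p q
      exact congrFun (congrFun (hρ i) p) q
    · rw [hρ i₁, hr₁]
      exact (hφT _ (h21 (hO2 hx))).1
  · rintro ρ ⟨⟨a', hA⟩, ⟨b', c', hb1, hb2, hb3, hBm⟩, hcomm⟩ hmem
    rw [hBm] at hmem
    change (ρ (S i₀)).1 = _ at hA
    change (ρ (S i₁)).1 = _ at hBm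
    set x := traceCoords γ ρ.character with hx
    have hb'B : b' ∈ B := by simpa using hmem
    have hax : a x = a' := by
      simp only [a, hx, he, SL2Rep.character, hA]
      simp [Matrix.trace_fin_two]
    have hβ : h (S i₁) x = b' + 1 / b' := by
      simp only [hx, he, SL2Rep.character, hBm]
      simp [Matrix.trace_fin_two]
    have hbx : b x = b' := by
      simp only [b, hβ]
      exact (hφB _ hb'B).2
    have hcx : c x = c' := by
      simp only [c, hax, hbx]
      simp only [hx, he, SL2Rep.character, map_mul, Matrix.SpecialLinearGroup.coe_mul, hA, hBm]
      simp [Matrix.trace_fin_two]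
    have hD : pairDisc a' b' c' ≠ 0 := by
      rw [← trace_commutator_normal_form hA hBm, sub_ne_zero]
      simpa only [SL2Rep.character, map_mul, map_inv] using hcomm
    have hRx : ∀ i, R i x = (ρ (S i)).1 := fun i => by
      simp only [R, hax, hbx, hcx]
      simp only [hx, he, SL2Rep.character, map_mul, Matrix.SpecialLinearGroup.coe_mul]
      exact matrixOfTraces_eq hD hA hBm _
    have hdx : ∀ i, (R i x).det = 1 := fun i => by rw [hRx]; exact (ρ (S i)).2
    refine ⟨Set.mem_iInter.mpr fun i => ⟨⟨?_, ?_⟩, ?_⟩, ?_⟩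
    · show h (S i₁) x ∈ T
      rw [hβ]
      exact (hφB _ hb'B).1
    · show pairDisc (a x) (b x) (c x) ≠ 0
      rwa [hax, hbx, hcx]
    · show (R i x).det ∈ Complex.slitPlane
      rw [hdx]
      exact Complex.one_mem_slitPlane
    · have hrx : ∀ i, r x i = (ρ (S i)).1 := fun i => by
        by_cases h0 : i = i₀
        · simp only [r, if_pos h0, hax]
          rw [h0]; exact hA.symm
        by_cases h1 : i = i₁
        · simp only [r, if_neg h0, if_pos h1, hbx, hcx]
          rw [h1]; exact hBm.symm
        · simp only [r, if_neg h0, if_neg h1]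
          rw [hdx, invSqrt_one, one_smul, hRx]
      funext i p q
      exact congrFun (congrFun (hrx i) p) q

/-- A representation whose restriction to the first two basis elements has no common eigenvector
has the same character as a good representation, with any choice of the eigenvalue. -/
theorem exists_good_of_character (hk : 2 ≤ k) (S : FreeGroupBasis (Fin k) F) (ρ : SL2Rep F)
    {b : ℂ} (hb0 : b ≠ 0) (hb1 : b ≠ 1) (hb2 : b ≠ -1)
    (hcomm : ρ.character (S ⟨0, by omega⟩ * S ⟨1, by omega⟩ * (S ⟨0, by omega⟩)⁻¹ *
        (S ⟨1, by omega⟩)⁻¹) ≠ 2)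
    (htr : ρ.character (S ⟨1, by omega⟩) = b + 1 / b) :
    ∃ ρ' ∈ goodRepresentations hk S, ρ'.character = ρ.character ∧
      (ρ' (S ⟨1, by omega⟩)).1 0 0 = b := by
  have hcomm' := hcomm
  simp only [SL2Rep.character, map_mul, map_inv] at hcomm'
  obtain ⟨Q, ⟨a, hA⟩, c, hB⟩ := exists_conj_normal_form hb0 htr hcomm'
  let ρ' : SL2Rep F := (MulAut.conj Q).toMonoidHom.comp ρ
  have hρ' : ∀ g, ρ' g = Q * ρ g * Q⁻¹ := fun g => rfl
  have hch : ρ'.character = ρ.character := by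
    funext g
    simp only [SL2Rep.character, hρ']
    exact trace_conj Q (ρ g)
  refine ⟨ρ', ⟨⟨a, ?_⟩, ⟨b, c, hb0, hb1, hb2, ?_⟩, ?_⟩, hch, ?_⟩
  · rw [hρ']; exact hA
  · rw [hρ']; exact hB
  · rw [hch]; exact hcomm
  · rw [hρ', hB]; rfl

end Coordinates

/-! ### The local parametrization by good representations and smoothness -/

theorem theorem4p5 {F : Type*} [Group F] {k : ℕ} (hk : 2 ≤ k)
    (hF : Nonempty (FreeGroupBasis (Fin k) F))
    {n : ℕ} (γ : Fin n → F) (hγ : IsTraceCoordinateSystem γ)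
    (x₀ : F → ℂ) (hx₀ : ∃ ρ₀ : SL2Rep F, ρ₀.IsIrreducible ∧ ρ₀.character = x₀) :
    IsSmoothPoint (characterVariety γ) (traceCoords γ x₀) ∧
    ∃ U : Set (Fin n → ℂ), IsRelOpen (characterVariety γ) U ∧ traceCoords γ x₀ ∈ U ∧
    ∃ S : FreeGroupBasis (Fin k) F,
    ∃ V : Set (Fin k → Fin 2 → Fin 2 → ℂ), IsRelOpen (repCoords S '' goodRepresentations hk S) V ∧
    ∃ f : V ≃ U, IsDiffeoOfSubsets f ∧
      ∀ (ρ : SL2Rep F) (hρ : repCoords S ρ ∈ V),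
        (f ⟨repCoords S ρ, hρ⟩ : Fin n → ℂ) = traceCoords γ ρ.character := by
  obtain ⟨ρ₀, hirr, rfl⟩ := hx₀
  obtain ⟨S₀⟩ := hF
  obtain ⟨S, hS₁, hS₂⟩ := exists_adapted_basis hk hirr S₀
  obtain ⟨b₀, hb₀, htr₀⟩ : ∃ b₀ : ℂ, b₀ ≠ 0 ∧ ρ₀.character (S ⟨1, by omega⟩) = b₀ + 1 / b₀ := by
    obtain ⟨s, hs⟩ := IsAlgClosed.exists_eq_mul_self
      (ρ₀.character (S ⟨1, by omega⟩) ^ 2 - 4)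
    generalize ρ₀.character (S ⟨1, by omega⟩) = t at hs
    -- The roots (t ± s)/2 of b² - tb + 1 have product 1.
    have h0 : (t + s) / 2 ≠ 0 := by
      intro h0
      have : (4 : ℂ) = 0 := by linear_combination 2 * (t - s) * h0 - hs
      norm_num at this
    refine ⟨(t + s) / 2, h0, ?_⟩
    have h1 : t + s ≠ 0 := fun h => h0 (by rw [h, zero_div])
    field_simp
    linear_combination hs
  have hb₁ : b₀ ≠ 1 := by rintro rfl; exact hS₂ (by rw [htr₀]; norm_num)
  have hb₂ : b₀ ≠ -1 := by rintro rfl; exact hS₂ (by rw [htr₀]; norm_num)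
  obtain ⟨B, T, φ, hB, hT, hb₀B, hφ, hφT, hφB, hB'⟩ := exists_add_inv_branch hb₀ hb₁ hb₂
  obtain ⟨O, r, hO, hr, hrO, hrρ⟩ := exists_smooth_inverse hk S hγ hT hφ hφT hφB hB'
  obtain ⟨τ, hτ, hτρ⟩ := exists_contDiff_traceCoords S γ
  obtain ⟨hβ, hβs, hβρ⟩ := hγ.exists_contDiff (S ⟨1, by omega⟩)
  obtain ⟨hκ, hκs, hκρ⟩ := hγ.exists_contDiff (S ⟨0, by omega⟩ * S ⟨1, by omega⟩ *
    (S ⟨0, by omega⟩)⁻¹ * (S ⟨1, by omega⟩)⁻¹)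
  -- Restricting the eigenvalue to `B` selects one of the two good representations, for b and 1/b,
  -- that share a character.
  let V : Set (Fin k → Fin 2 → Fin 2 → ℂ) := repCoords S '' goodRepresentations hk S ∩
    (fun m => m ⟨1, by omega⟩ 0 0) ⁻¹' B
  let W : Set (Fin n → ℂ) := hβ ⁻¹' T ∩ hκ ⁻¹' {2}ᶜ
  let U : Set (Fin n → ℂ) := characterVariety γ ∩ W
  have hW : IsOpen W := (hT.preimage hβs.continuous).inter
    (isOpen_compl_singleton.preimage hκs.continuous)
  have hVU : ∀ m ∈ V, τ m ∈ U := by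
    rintro _ ⟨⟨ρ, hρ, rfl⟩, hρB⟩
    rw [hτρ]
    refine ⟨⟨_, ⟨ρ, rfl⟩, rfl⟩, ?_, ?_⟩
    · obtain ⟨-, ⟨b, c, -, -, -, hb⟩, -⟩ := hρ
      have hbB : b ∈ B := by
        have : repCoords S ρ ⟨1, by omega⟩ 0 0 = b := by
          simp only [repCoords, hb]; rfl
        rw [← this]; exact hρB
      show hβ _ ∈ T
      rw [hβρ, SL2Rep.character, hb]
      simpa [Matrix.trace_fin_two] using (hφB b hbB).1
    · show hκ _ ≠ 2
      rw [hκρ]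
      exact hρ.2.2
  have hUV : ∀ x ∈ U, ∃ ρ ∈ goodRepresentations hk S, (ρ (S ⟨1, by omega⟩)).1 0 0 ∈ B ∧
      traceCoords γ ρ.character = x := by
    rintro _ ⟨⟨_, ⟨ρ, rfl⟩, rfl⟩, h1, h2⟩
    have h1' : hβ (traceCoords γ ρ.character) ∈ T := h1
    have h2' : hκ (traceCoords γ ρ.character) ≠ 2 := h2
    rw [hβρ] at h1'
    rw [hκρ] at h2'
    obtain ⟨h3, h4⟩ := hφT _ h1'
    obtain ⟨h5, h6, h7⟩ := hB' _ h3
    obtain ⟨ρ', hg, hch, hb⟩ := exists_good_of_character hk S ρ h5 h6 h7 h2' h4.symm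
    exact ⟨ρ', hg, by rw [hb]; exact h3, by rw [hch]⟩
  have hrV : ∀ x ∈ O, r x ∈ V := by
    intro x hx
    obtain ⟨ρ, hρ, h1, h2⟩ := hrO x hx
    exact ⟨⟨ρ, hρ, h1⟩, by rw [← h1]; exact h2⟩
  have hrτ : ∀ m ∈ V, r (τ m) = m := by
    rintro _ ⟨⟨ρ, hρ, rfl⟩, hρB⟩
    rw [hτρ]
    exact (hrρ ρ hρ hρB).2
  have hUO : U ⊆ O := by
    intro x hx
    obtain ⟨ρ, hρ, hb, rfl⟩ := hUV x hx
    exact (hrρ ρ hρ hb).1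
  have hτr : ∀ x ∈ U, τ (r x) = x := by
    intro x hx
    obtain ⟨ρ, hρ, hb, rfl⟩ := hUV x hx
    rw [(hrρ ρ hρ hb).2, hτρ]
  have hx₀U : traceCoords γ ρ₀.character ∈ U := by
    refine ⟨⟨_, ⟨ρ₀, rfl⟩, rfl⟩, ?_, ?_⟩
    · show hβ _ ∈ T
      rw [hβρ, htr₀]
      exact (hφB _ hb₀B).1
    · show hκ _ ≠ 2
      rw [hκρ]
      exact hS₁
  refine ⟨?_, U, ⟨W, hW, rfl⟩, hx₀U, S, V, ⟨_, hB.preimage (by fun_prop), rfl⟩, ?_⟩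
  -- `τ ∘ r` maps `O` into `U` and fixes `U` pointwise.
  · obtain ⟨W', hW', hx₀W', d, hd⟩ := exists_isSmoothSubmanifold_of_retraction (q := τ ∘ r) hO
      (hτ.comp_contDiffOn hr) hUO (fun x hx => hVU _ (hrV x hx)) hτr hx₀U
    exact ⟨U ∩ W', ⟨W ∩ W', hW.inter hW', Set.inter_assoc _ _ _⟩, ⟨hx₀U, hx₀W'⟩, d, hd⟩
  · let f : V ≃ U :=
      { toFun := fun m => ⟨τ m, hVU _ m.2⟩
        invFun := fun x => ⟨r x, hrV _ (hUO x.2)⟩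
        left_inv := fun m => Subtype.ext (hrτ _ m.2)
        right_inv := fun x => Subtype.ext (hτr _ x.2) }
    exact ⟨f, ⟨⟨Set.univ, τ, isOpen_univ, Set.subset_univ _, hτ.contDiffOn, fun _ => rfl⟩,
      ⟨O, r, hO, hUO, hr, fun _ => rfl⟩⟩, fun ρ _ => hτρ ρ⟩
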